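/- Let $m\ge 0$, let $q:\mathbb R\to\mathbb R$ be locally integrable and periodic with period $a>0$, and let $\sigma_2=\begin{pmatrix}0&-i\\ i&0\end{pmatrix}$, $\sigma_3=\begin{pmatrix}1&0\\0&-1\end{pmatrix}$. Let $H_0=-i\sigma_2\frac{d}{dx}+m\sigma_3+q$ be the Dirac operator in $L^2(\mathbb R)^2=L^2(\mathbb R;\mathbb C^2)$ with its natural (maximal) domain, consisting of all locally absolutely continuous $u\in L^2(\mathbb R)^2$ such that $-i\sigma_2u'+(m\sigma_3+q)u\in L^2(\mathbb R)^2$. Let $\varrho(H_0)$ be its resolvent set, i.e. the set of $\lambda\in\mathbb C$ for which $H_0-\lambda$ maps the domain of $H_0$ bijectively onto $L^2(\mathbb R)^2$ with bounded inverse. Let $1\le p<\infty$ and let $A\in L^{2p}(\mathbb R)^{2\times 2}$, i.e. $A:\mathbb R\to\mathbb C^{2\times2}$ is measurable and $\int_{\mathbb R}\|A(x)\|^{2p}\,dx<\infty$, where $\|A(x)\|$ is the operator norm of the matrix $A(x)$. Denote also by $A$ the operator of multiplication by $A$ in $L^2(\mathbb R)^2$ with maximal domain $\{f\in L^2(\mathbb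 R)^2 : Af\in L^2(\mathbb R)^2\}$. Then for every $\lambda\in\varrho(H_0)$ the range of $(H_0-\lambda)^{-1}$ is contained in the domain of the multiplication operator $A$, and the everywhere defined operator $A\,(H_0-\lambda)^{-1}$ is compact on $L^2(\mathbb R)^2$. -/

import Mathlib

open MeasureTheory

namespace PeriodicDirac

/-- The spinor space `ℂ²` with its Euclidean norm. -/
abbrev Spinor : Type := EuclideanSpace ℂ (Fin 2)

/-- The Hilbert space `L²(ℝ)²` of (classes of) square-integrable functions `ℝ → ℂ²`. -/
abbrev L2 : Type := Lp Spinor 2 (volume : Measure ℝ)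

/-- The linear map of `ℂ²` given by a complex `2 × 2` matrix. -/
noncomputable abbrev act (M : Matrix (Fin 2) (Fin 2) ℂ) : Spinor →L[ℂ] Spinor :=
  Matrix.toEuclideanCLM (n := Fin 2) (𝕜 := ℂ) M

/-- The Pauli matrix `σ₂`. -/
def pauli2 : Matrix (Fin 2) (Fin 2) ℂ := !![0, -Complex.I; Complex.I, 0]

/-- The Pauli matrix `σ₃`. -/
def pauli3 : Matrix (Fin 2) (Fin 2) ℂ := !![1, 0; 0, -1]

/-- The Dirac differential expression `-i σ₂ u' + (m σ₃ + q) u`, evaluated at the point `x`. -/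
noncomputable def diracExpr (m : ℝ) (q : ℝ → ℝ) (u : ℝ → Spinor) (x : ℝ) : Spinor :=
  -Complex.I • act pauli2 (deriv u x) + ((m : ℂ) • act pauli3 (u x) + (q x : ℂ) • u x)

/-- Local absolute continuity on the real line: absolute continuity on every compact interval. -/
def LocallyAC (u : ℝ → Spinor) : Prop :=
  ∀ a b : ℝ, AbsolutelyContinuousOnInterval u a b

theorem LocallyAC.add {u v : ℝ → Spinor} (hu : LocallyAC u) (hv : LocallyAC v) :
    LocallyAC (u + v) :=
  fun a b => (hu a b).add (hv a b)

theorem LocallyAC.smul {u : ℝ → Spinor} (c : ℂ) (hu : LocallyAC u) : LocallyAC (c • u) :=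
  fun a b => (hu a b).const_smul c

theorem LocallyAC.continuous {u : ℝ → Spinor} (hu : LocallyAC u) : Continuous u := by
  rw [continuous_iff_continuousAt]
  intro x
  refine (hu (x - 1) (x + 1)).continuousOn.continuousAt ?_
  rw [Set.uIcc_of_le (by linarith)]
  exact Icc_mem_nhds (by linarith) (by linarith)

theorem LocallyAC.ae_differentiableAt {u : ℝ → Spinor} (hu : LocallyAC u) :
    ∀ᵐ x : ℝ, DifferentiableAt ℝ u x := by
  have hfd : FiniteDimensional ℝ Spinor := FiniteDimensional.complexToReal Spinor
  have key : LocallyBoundedVariationOn u Set.univ := by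
    intro a b _ _
    rcases le_total a b with h | h
    · have := (hu a b).boundedVariationOn
      rw [Set.uIcc_of_le h] at this
      exact this.mono Set.inter_subset_right
    · refine ne_of_lt (lt_of_le_of_lt (le_of_eq (eVariationOn.subsingleton u ?_)) ENNReal.zero_lt_top)
      intro x hx y hy
      have h1 := hx.2
      have h2 := hy.2
      exact le_antisymm (by linarith [h1.1, h1.2, h2.1, h2.2])
        (by linarith [h1.1, h1.2, h2.1, h2.2])
  exact key.ae_differentiableAt

theorem diracExpr_add (m : ℝ) (q : ℝ → ℝ) {u v : ℝ → Spinor}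
    (hu : LocallyAC u) (hv : LocallyAC v) :
    diracExpr m q (u + v) =ᵐ[volume] diracExpr m q u + diracExpr m q v := by
  filter_upwards [hu.ae_differentiableAt, hv.ae_differentiableAt] with x h1 h2
  simp only [diracExpr, Pi.add_apply, deriv_add h1 h2, map_add, smul_add]
  abel

theorem diracExpr_smul (m : ℝ) (q : ℝ → ℝ) (c : ℂ) {u : ℝ → Spinor} (hu : LocallyAC u) :
    diracExpr m q (c • u) =ᵐ[volume] c • diracExpr m q u := by
  filter_upwards [hu.ae_differentiableAt] with x h1
  have h2 : deriv (c • u) x = c • deriv u x := (h1.hasDerivAt.const_smul c).deriv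
  simp only [diracExpr, Pi.smul_apply, h2, map_smul, smul_add, smul_comm c]

/-- The function `u` is the locally absolutely continuous representative of `f`, and the Dirac
differential expression maps it into `L²(ℝ)²`. -/
structure IsDomainRep (m : ℝ) (q : ℝ → ℝ) (f : L2) (u : ℝ → Spinor) : Prop where
  ae_eq : f =ᵐ[volume] u
  locallyAC : LocallyAC u
  memLp : MemLp (diracExpr m q u) 2 volume

theorem IsDomainRep.add {m : ℝ} {q : ℝ → ℝ} {f g : L2} {u v : ℝ → Spinor}
    (hu : IsDomainRep m q f u) (hv : IsDomainRep m q g v) :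
    IsDomainRep m q (f + g) (u + v) :=
  ⟨(Lp.coeFn_add f g).trans (hu.ae_eq.add hv.ae_eq), hu.locallyAC.add hv.locallyAC,
    (hu.memLp.add hv.memLp).ae_eq (diracExpr_add m q hu.locallyAC hv.locallyAC).symm⟩

theorem IsDomainRep.smul {m : ℝ} {q : ℝ → ℝ} {f : L2} {u : ℝ → Spinor} (c : ℂ)
    (hu : IsDomainRep m q f u) : IsDomainRep m q (c • f) (c • u) :=
  ⟨(Lp.coeFn_smul c f).trans (hu.ae_eq.const_smul c), hu.locallyAC.smul c,
    (hu.memLp.const_smul c).ae_eq (diracExpr_smul m q c hu.locallyAC).symm⟩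

theorem IsDomainRep.zero (m : ℝ) (q : ℝ → ℝ) : IsDomainRep m q 0 0 := by
  have h0 : LocallyAC (0 : ℝ → Spinor) := fun a b =>
    (LipschitzWith.const (0 : Spinor)).lipschitzOnWith.absolutelyContinuousOnInterval
  have h1 : diracExpr m q 0 = 0 := by
    funext x
    have h2 : deriv (0 : ℝ → Spinor) x = 0 := by simp
    simp [diracExpr, h2]
  exact ⟨Lp.coeFn_zero _ _ _, h0, by rw [h1]; exact MemLp.zero⟩

theorem IsDomainRep.unique {m : ℝ} {q : ℝ → ℝ} {f : L2} {u v : ℝ → Spinor}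
    (hu : IsDomainRep m q f u) (hv : IsDomainRep m q f v) : u = v :=
  (hu.locallyAC.continuous.ae_eq_iff_eq volume hv.locallyAC.continuous).1
    (hu.ae_eq.symm.trans hv.ae_eq)

/-- The Dirac operator `H₀ = -i σ₂ d/dx + m σ₃ + q` in `L²(ℝ)²`, with its natural (maximal) domain:
all `f ∈ L²(ℝ)²` that are locally absolutely continuous and for which
`-i σ₂ f' + (m σ₃ + q) f` lies in `L²(ℝ)²`. -/
noncomputable def H0 (m : ℝ) (q : ℝ → ℝ) : L2 →ₗ.[ℂ] L2 where
  domain :=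
    { carrier := {f | ∃ u, IsDomainRep m q f u}
      zero_mem' := ⟨0, IsDomainRep.zero m q⟩
      add_mem' := fun ⟨_, hu⟩ ⟨_, hv⟩ => ⟨_, hu.add hv⟩
      smul_mem' := fun c _ ⟨_, hu⟩ => ⟨_, hu.smul c⟩ }
  toFun :=
    { toFun := fun f => f.2.choose_spec.memLp.toLp (diracExpr m q f.2.choose)
      map_add' := fun f g => by
        have hu := f.2.choose_spec
        have hv := g.2.choose_spec
        have hw := (f + g).2.choose_spec
        rw [← MemLp.toLp_add, MemLp.toLp_eq_toLp_iff, hw.unique (hu.add hv)]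
        exact diracExpr_add m q hu.locallyAC hv.locallyAC
      map_smul' := fun c f => by
        have hu := f.2.choose_spec
        have hw := (c • f).2.choose_spec
        rw [RingHom.id_apply, ← MemLp.toLp_const_smul, MemLp.toLp_eq_toLp_iff,
          hw.unique (hu.smul c)]
        exact diracExpr_smul m q c hu.locallyAC }

theorem mem_H0_domain_iff {m : ℝ} {q : ℝ → ℝ} {f : L2} :
    f ∈ (H0 m q).domain ↔ ∃ u, IsDomainRep m q f u :=
  Iff.rfl

theorem H0_apply_ae {m : ℝ} {q : ℝ → ℝ} (f : (H0 m q).domain) {u : ℝ → Spinor}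
    (hu : IsDomainRep m q f u) : H0 m q f =ᵐ[volume] diracExpr m q u := by
  have h := f.2.choose_spec
  rw [← h.unique hu]
  exact h.memLp.coeFn_toLp

/-- `R` is a bounded, everywhere defined two-sided inverse of `T - z`. -/
structure IsResolventAt (T : L2 →ₗ.[ℂ] L2) (z : ℂ) (R : L2 →L[ℂ] L2) : Prop where
  right_inv : ∀ f : L2, ∃ h : R f ∈ T.domain, T ⟨R f, h⟩ - z • R f = f
  left_inv : ∀ g : T.domain, R (T g - z • (g : L2)) = g

theorem IsResolventAt.unique {T : L2 →ₗ.[ℂ] L2} {z : ℂ} {R S : L2 →L[ℂ] L2}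
    (hR : IsResolventAt T z R) (hS : IsResolventAt T z S) : R = S := by
  ext1 f
  obtain ⟨h, e⟩ := hR.right_inv f
  have := hS.left_inv ⟨R f, h⟩
  rw [e] at this
  exact this.symm

/-- The resolvent set of an unbounded operator `T`: all `z ∈ ℂ` for which `T - z` maps the domain
of `T` bijectively onto the whole space, with bounded inverse. -/
def resolventSet (T : L2 →ₗ.[ℂ] L2) : Set ℂ := {z | ∃ R : L2 →L[ℂ] L2, IsResolventAt T z R}

open Classical in
/-- The resolvent `(T - z)⁻¹`, for `z` in the resolvent set of `T` (and `0` otherwise). -/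
noncomputable def resolvent (T : L2 →ₗ.[ℂ] L2) (z : ℂ) : L2 →L[ℂ] L2 :=
  if h : ∃ R : L2 →L[ℂ] L2, IsResolventAt T z R then h.choose else 0

theorem isResolventAt_resolvent {T : L2 →ₗ.[ℂ] L2} {z : ℂ} (hz : z ∈ resolventSet T) :
    IsResolventAt T z (resolvent T z) := by
  have hz' : ∃ R : L2 →L[ℂ] L2, IsResolventAt T z R := hz
  rw [resolvent, dif_pos hz']
  exact hz'.choose_spec

/-- The (in general unbounded) operator of multiplication by the matrix function `A` in `L²(ℝ)²`,
with its maximal domain `{f | A f ∈ L²(ℝ)²}`. -/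
noncomputable def mulOp (A : ℝ → Matrix (Fin 2) (Fin 2) ℂ) : L2 →ₗ.[ℂ] L2 where
  domain :=
    { carrier := {f | MemLp (fun x => act (A x) (f x)) 2 volume}
      zero_mem' := by
        refine (MemLp.zero (ε := Spinor)).ae_eq ?_
        filter_upwards [Lp.coeFn_zero Spinor 2 (volume : Measure ℝ)] with x hx
        simp only [hx, Pi.zero_apply, map_zero]
      add_mem' := fun {f g} hf hg => by
        refine (MemLp.add hf hg).ae_eq ?_
        filter_upwards [Lp.coeFn_add f g] with x hx
        simp only [hx, Pi.add_apply, map_add]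
      smul_mem' := fun c f hf => by
        refine (MemLp.const_smul hf c).ae_eq ?_
        filter_upwards [Lp.coeFn_smul c f] with x hx
        simp only [hx, Pi.smul_apply, map_smul] }
  toFun :=
    { toFun := fun f => f.2.toLp (fun x => act (A x) ((f : L2) x))
      map_add' := fun f g => by
        rw [← MemLp.toLp_add, MemLp.toLp_eq_toLp_iff]
        filter_upwards [Lp.coeFn_add (f : L2) (g : L2)] with x hx
        simp only [Submodule.coe_add, hx, Pi.add_apply, map_add]
      map_smul' := fun c f => by
        rw [RingHom.id_apply, ← MemLp.toLp_const_smul, MemLp.toLp_eq_toLp_iff]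
        filter_upwards [Lp.coeFn_smul c (f : L2)] with x hx
        simp only [Submodule.coe_smul, hx, Pi.smul_apply, map_smul] }

/-- The matrix function `A` belongs to `L^r(ℝ)^{2×2}`: it is (almost everywhere strongly) measurable
and the operator norm `x ↦ ‖A(x)‖` has finite `L^r` norm. -/
def MatrixMemLp (A : ℝ → Matrix (Fin 2) (Fin 2) ℂ) (r : ENNReal) : Prop :=
  MemLp (fun x => act (A x)) r volume

end PeriodicDirac

/-! Since `q` is real and `-iσ₂` is a real rotation by a right angle, `q` drops out of `(|u|²)' = 2
Re⟨u, u'⟩`. For `u` in the domain this derivative is thus dominated by `(1 + 2|m|)|u|² + |H₀u|²`,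
which is integrable, and `sup |u|` is bounded by the graph norm (`IsDomainRep.norm_sq_le`). Point
evaluations of the resolvent are therefore uniformly bounded functionals
(`IsResolventAt.exists_eval`). For `B` in `L²`, Bessel's inequality at each point makes `B (H₀ -
z)⁻¹` Hilbert-Schmidt, hence compact. A function in `L^{2p}` is a uniformly small function plus one
in `L²`, so `A (H₀ - z)⁻¹` is a norm limit of compact operators. -/

namespace PeriodicDirac

/-! ### Hilbert-Schmidt operators and Bessel's inequality -/

/-- An operator that is Hilbert-Schmidt is compact. -/
theorem isCompactOperator_of_sum_norm_sq_le {ι H F : Type*} [NormedAddCommGroup H]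
    [InnerProductSpace ℂ H] [NormedAddCommGroup F] [NormedSpace ℂ F] [CompleteSpace F]
    (b : HilbertBasis ι ℂ H) (T : H →L[ℂ] F) (K : ℝ)
    (hK : ∀ s : Finset ι, ∑ i ∈ s, ‖T (b i)‖ ^ 2 ≤ K) : IsCompactOperator T := by
  classical
  have hsum : Summable fun i => ‖T (b i)‖ ^ 2 :=
    summable_of_sum_le (fun i => by positivity) hK
  -- Finite-rank truncations of the basis expansion; they will converge to `T` in operator norm.
  let S : Finset ι → H →L[ℂ] F := fun s =>
    ∑ i ∈ s, (innerSL ℂ (b i)).smulRight (T (b i))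
  have hS : ∀ s, IsCompactOperator (S s) := by
    intro s
    have : ∀ i ∈ s, (innerSL ℂ (b i)).smulRight (T (b i)) ∈ compactOperator (RingHom.id ℂ) H F := by
      intro i _
      have h1 : IsCompactOperator (innerSL ℂ (b i) : H →L[ℂ] ℂ) :=
        isCompactOperator_of_locallyCompactSpace_dom (innerSL ℂ (b i) : H →L[ℂ] ℂ)
      exact h1.clm_comp (ContinuousLinearMap.toSpanSingleton ℂ (T (b i)))
    exact Submodule.sum_mem _ this
  refine isCompactOperator_of_tendsto (F := S) (l := Filter.atTop) ?_ (.of_forall hS)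
  rw [Metric.tendsto_atTop]
  intro ε hε
  obtain ⟨s₀, hs₀⟩ := (summable_iff_vanishing_norm.1 hsum) ((ε / 2) ^ 2) (by positivity)
  refine ⟨s₀, fun s hs => ?_⟩
  rw [dist_eq_norm, norm_sub_rev]
  refine lt_of_le_of_lt (ContinuousLinearMap.opNorm_le_bound _ (half_pos hε).le fun f => ?_)
    (half_lt_self hε)
  have h1 : Filter.Tendsto (fun t => S t f - S s f) Filter.atTop (nhds (T f - S s f)) := by
    refine Filter.Tendsto.sub_const ?_ _
    have := (b.hasSum_repr f).mapL T
    simpa [S, HasSum, b.repr_apply_apply] using this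
  refine le_of_tendsto h1.norm ?_
  filter_upwards [Filter.eventually_ge_atTop s] with t ht
  have h2 : S t f - S s f = ∑ i ∈ t \ s, inner ℂ (b i) f • T (b i) := by
    simp [S, ← Finset.sum_sdiff ht]
  have h3 : ∑ i ∈ t \ s, ‖T (b i)‖ ^ 2 < (ε / 2) ^ 2 := by
    have := hs₀ (t \ s) (Finset.sdiff_disjoint.mono_right hs)
    rwa [Real.norm_of_nonneg (by positivity)] at this
  have h4 : ∑ i ∈ t \ s, ‖inner ℂ (b i) f‖ ^ 2 ≤ ‖f‖ ^ 2 :=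
    b.orthonormal.sum_inner_products_le f
  rw [h2]
  calc ‖∑ i ∈ t \ s, inner ℂ (b i) f • T (b i)‖
      ≤ ∑ i ∈ t \ s, ‖inner ℂ (b i) f‖ * ‖T (b i)‖ :=
        (norm_sum_le _ _).trans_eq (by simp only [norm_smul])
    _ ≤ √(∑ i ∈ t \ s, ‖inner ℂ (b i) f‖ ^ 2) * √(∑ i ∈ t \ s, ‖T (b i)‖ ^ 2) :=
        Real.sum_mul_le_sqrt_mul_sqrt _ _ _
    _ ≤ ‖f‖ * (ε / 2) := by
        gcongr
        · exact Real.sqrt_le_iff.2 ⟨norm_nonneg _, h4⟩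
        · exact Real.sqrt_le_iff.2 ⟨by positivity, h3.le⟩
    _ = ε / 2 * ‖f‖ := mul_comm _ _

/-- Bessel's inequality for a functional. -/
theorem sum_norm_sq_functional_le {ι H : Type*} [NormedAddCommGroup H]
    [InnerProductSpace ℂ H] [CompleteSpace H] {e : ι → H} (he : Orthonormal ℂ e)
    (φ : H →L[ℂ] ℂ) (s : Finset ι) : ∑ i ∈ s, ‖φ (e i)‖ ^ 2 ≤ ‖φ‖ ^ 2 := by
  have h := he.sum_inner_products_le (s := s) ((InnerProductSpace.toDual ℂ H).symm φ)
  rw [LinearIsometryEquiv.norm_map] at h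
  refine le_trans (le_of_eq (Finset.sum_congr rfl fun i _ => ?_)) h
  rw [← InnerProductSpace.toDual_symm_apply, norm_inner_symm]

/-- Bessel's inequality for each of the two coordinate functionals; the factor 2 is the dimension of
`ℂ²`. -/
theorem sum_norm_sq_apply_le {ι H : Type*} [NormedAddCommGroup H]
    [InnerProductSpace ℂ H] [CompleteSpace H] {e : ι → H} (he : Orthonormal ℂ e)
    (L : H →L[ℂ] Spinor) (s : Finset ι) : ∑ i ∈ s, ‖L (e i)‖ ^ 2 ≤ 2 * ‖L‖ ^ 2 := by
  have h : ∀ j : Fin 2, ∑ i ∈ s, ‖L (e i) j‖ ^ 2 ≤ ‖L‖ ^ 2 := by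
    intro j
    refine (sum_norm_sq_functional_le he ((EuclideanSpace.proj j).comp L) s).trans ?_
    gcongr
    refine ContinuousLinearMap.opNorm_le_bound _ (norm_nonneg _) fun f => ?_
    exact (PiLp.norm_apply_le (L f) j).trans (L.le_opNorm f)
  simp only [EuclideanSpace.norm_sq_eq, Fin.sum_univ_two, Finset.sum_add_distrib]
  linarith [h 0, h 1]

theorem L2_norm_sq_eq_integral (f : L2) : ‖f‖ ^ 2 = ∫ x, ‖f x‖ ^ 2 := by
  have h := inner_self_eq_norm_sq_to_K (𝕜 := ℂ) f
  rw [L2.inner_def] at h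
  simp only [inner_self_eq_norm_sq_to_K] at h
  have h2 : ((∫ x, ‖f x‖ ^ 2 : ℝ) : ℂ) = ((‖f‖ ^ 2 : ℝ) : ℂ) := by
    rw [← integral_complex_ofReal]
    push_cast
    exact h
  exact_mod_cast h2.symm

theorem L2_integrable_norm_sq (f : L2) : Integrable (fun x => ‖f x‖ ^ 2) :=
  (Lp.memLp f).integrable_norm_pow (by norm_num)

/-! ### Sup bound by the graph norm -/

theorem norm_act_pauli2 (u : Spinor) : ‖-Complex.I • act pauli2 u‖ = ‖u‖ := by
  rw [norm_smul]
  simp [EuclideanSpace.norm_eq, pauli2, Fin.sum_univ_two, Matrix.vecHead, Matrix.vecTail]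
  rw [add_comm]

theorem norm_act_pauli3 (u : Spinor) : ‖act pauli3 u‖ = ‖u‖ := by
  simp [EuclideanSpace.norm_eq, pauli3, Fin.sum_univ_two, Matrix.vecHead, Matrix.vecTail]

/-- The matrix `J = -iσ₂` is real, orthogonal and skew, so `⟨Ju, Jw⟩ = ⟨u, w⟩` and `Re⟨Ju, q u⟩ =
0`. The mass term has no such cancellation and is moved into `v`. -/
theorem re_inner_eq_of_dirac (q : ℝ) (u w v : Spinor)
    (h : v = -Complex.I • act pauli2 w + (q : ℂ) • u) :
    (inner ℂ u w).re = (inner ℂ (-Complex.I • act pauli2 u) v).re := by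
  subst h
  simp [pauli2, PiLp.inner_apply, Fin.sum_univ_two, Matrix.vecHead, Matrix.vecTail]
  ring

theorem LocallyAC.norm_sq {u : ℝ → Spinor} (hu : LocallyAC u) (a b : ℝ) :
    AbsolutelyContinuousOnInterval (fun x => ‖u x‖ ^ 2) a b := by
  have h : AbsolutelyContinuousOnInterval (fun x => ‖u x‖) a b := by
    refine squeeze_zero (fun t => Finset.sum_nonneg fun i _ => dist_nonneg) (fun t => ?_) (hu a b)
    gcongr
    exact lipschitzWith_one_norm.dist_le_mul _ _ |>.trans_eq (by simp)
  simpa only [pow_two] using! h.mul h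

theorem deriv_norm_sq {u : ℝ → Spinor} {x : ℝ} (h : DifferentiableAt ℝ u x) :
    deriv (fun x => ‖u x‖ ^ 2) x = 2 * (inner ℂ (u x) (deriv u x)).re :=
  h.hasDerivAt.norm_sq.deriv

theorem abs_deriv_norm_sq_le (m : ℝ) (q : ℝ → ℝ) {u : ℝ → Spinor} {x : ℝ}
    (h : DifferentiableAt ℝ u x) :
    |deriv (fun x => ‖u x‖ ^ 2) x| ≤ (1 + 2 * |m|) * ‖u x‖ ^ 2 + ‖diracExpr m q u x‖ ^ 2 := by
  have h1 := re_inner_eq_of_dirac (q x) (u x) (deriv u x)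
    (diracExpr m q u x - (m : ℂ) • act pauli3 (u x)) (by rw [diracExpr]; abel)
  rw [deriv_norm_sq h, h1, abs_mul, abs_two]
  have h2 := (Complex.abs_re_le_norm _).trans (norm_inner_le_norm (𝕜 := ℂ)
    (-Complex.I • act pauli2 (u x)) (diracExpr m q u x - (m : ℂ) • act pauli3 (u x)))
  rw [norm_act_pauli2] at h2
  have h3 : ‖diracExpr m q u x - (m : ℂ) • act pauli3 (u x)‖ ≤
      ‖diracExpr m q u x‖ + |m| * ‖u x‖ := by
    refine (norm_sub_le _ _).trans_eq ?_
    rw [norm_smul, norm_act_pauli3, Complex.norm_real, Real.norm_eq_abs]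
  have h4 := mul_le_mul_of_nonneg_left h3 (norm_nonneg (u x))
  nlinarith [sq_nonneg (‖u x‖ - ‖diracExpr m q u x‖)]

/-- The representative of an element of the domain is bounded by its graph norm. -/
theorem IsDomainRep.norm_sq_le {m : ℝ} {q : ℝ → ℝ} {f : (H0 m q).domain} {u : ℝ → Spinor}
    (hu : IsDomainRep m q f u) (x : ℝ) :
    ‖u x‖ ^ 2 ≤ (2 + 2 * |m|) * ‖(f : L2)‖ ^ 2 + ‖H0 m q f‖ ^ 2 := by
  set h : ℝ → ℝ := fun y => ‖u y‖ ^ 2 with hh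
  set k : ℝ → ℝ := fun y => (1 + 2 * |m|) * ‖(f : L2) y‖ ^ 2 + ‖H0 m q f y‖ ^ 2 with hk
  have hf2 : Integrable fun y => ‖(f : L2) y‖ ^ 2 := L2_integrable_norm_sq _
  have hg2 : Integrable fun y => ‖H0 m q f y‖ ^ 2 := L2_integrable_norm_sq _
  have hkint : Integrable k := (hf2.const_mul _).add hg2
  have hk0 : ∀ y, 0 ≤ k y := fun y => by positivity
  have hkval : ∫ y, k y = (1 + 2 * |m|) * ‖(f : L2)‖ ^ 2 + ‖H0 m q f‖ ^ 2 := by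
    rw [hk, integral_add (hf2.const_mul _) hg2, integral_const_mul, L2_norm_sq_eq_integral,
      L2_norm_sq_eq_integral]
  have hderiv : ∀ᵐ y, |deriv h y| ≤ k y := by
    filter_upwards [hu.locallyAC.ae_differentiableAt, hu.ae_eq, H0_apply_ae f hu] with y h1 h2 h3
    rw [hk]
    simp only [h2, h3]
    exact abs_deriv_norm_sq_le m q h1
  -- Fundamental theorem of calculus for the absolutely continuous `|u|²`.
  have hstep : ∀ y, h x - ∫ t, k t ≤ h y := by
    intro y
    have e := (hu.locallyAC.norm_sq y x).integral_deriv_eq_sub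
    have e2 : |∫ t in y..x, deriv h t| ≤ ∫ t, k t := by
      rw [← Real.norm_eq_abs]
      refine intervalIntegral.norm_integral_le_integral_norm_uIoc.trans ?_
      refine (setIntegral_mono_on_ae ?_ hkint.integrableOn measurableSet_uIoc ?_).trans
        (setIntegral_le_integral hkint (.of_forall hk0))
      · exact (hu.locallyAC.norm_sq y x).intervalIntegrable_deriv.def'.norm
      · filter_upwards [hderiv] with t ht _ using ht
    rw [e] at e2
    linarith [le_abs_self (h x - h y)]
  have hhint : Integrable h := hf2.congr (by filter_upwards [hu.ae_eq] with y hy; rw [hy])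
  have hhval : ∫ y, h y = ‖(f : L2)‖ ^ 2 := by
    rw [L2_norm_sq_eq_integral]
    exact integral_congr_ae (by filter_upwards [hu.ae_eq] with y hy; rw [hy])
  -- Averaging over `y` in a unit interval costs one more `‖f‖²`, whence `2 + 2|m|`.
  have hfin : ∫ _ in Set.Ioc (0 : ℝ) 1, (h x - ∫ t, k t) ≤ ∫ y in Set.Ioc (0 : ℝ) 1, h y :=
    setIntegral_mono (by simp) hhint.integrableOn hstep
  have hfin2 : ∫ y in Set.Ioc (0 : ℝ) 1, h y ≤ ∫ y, h y :=
    setIntegral_le_integral hhint (.of_forall fun y => by positivity)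
  simp only [setIntegral_const, Real.volume_real_Ioc, sub_zero, max_eq_left zero_le_one,
    one_smul, hkval] at hfin
  change h x ≤ _
  linarith

/-- Point evaluations of the resolvent are uniformly bounded. -/
theorem IsResolventAt.exists_eval {m : ℝ} {q : ℝ → ℝ} {z : ℂ} {R : L2 →L[ℂ] L2}
    (hR : IsResolventAt (H0 m q) z R) :
    ∃ (C : ℝ) (E : ℝ → L2 →L[ℂ] Spinor), (∀ x, ‖E x‖ ≤ C) ∧ ∀ f, R f =ᵐ[volume] fun x => E x f := by
  have hrep : ∀ f, ∃ u, IsDomainRep m q (R f) u := fun f => (hR.right_inv f).choose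
  choose U hU using hrep
  set D : ℝ := (2 + 2 * |m|) * ‖R‖ ^ 2 + (1 + ‖z‖ * ‖R‖) ^ 2 with hD
  have hD0 : 0 ≤ D := by positivity
  have hbound : ∀ x f, ‖U f x‖ ≤ √D * ‖f‖ := by
    intro x f
    obtain ⟨h, e⟩ := hR.right_inv f
    have h1 := IsDomainRep.norm_sq_le (f := ⟨R f, h⟩) (hU f) x
    have h2 : ‖R f‖ ≤ ‖R‖ * ‖f‖ := R.le_opNorm f
    have h3 : ‖H0 m q ⟨R f, h⟩‖ ≤ (1 + ‖z‖ * ‖R‖) * ‖f‖ := by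
      rw [sub_eq_iff_eq_add.1 e]
      refine (norm_add_le _ _).trans ?_
      rw [norm_smul]
      nlinarith [mul_le_mul_of_nonneg_left h2 (norm_nonneg z)]
    refine abs_le_of_sq_le_sq' ?_ (by positivity) |>.2
    rw [mul_pow, Real.sq_sqrt hD0]
    calc _ ≤ _ := h1
      _ ≤ (2 + 2 * |m|) * (‖R‖ * ‖f‖) ^ 2 + ((1 + ‖z‖ * ‖R‖) * ‖f‖) ^ 2 := by gcongr
      _ = _ := by rw [hD]; ring
  refine ⟨√D, fun x => LinearMap.mkContinuous
    { toFun := fun f => U f x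
      map_add' := fun f g => ?_
      map_smul' := fun c f => ?_ } (√D) (hbound x), fun x => ?_, fun f => (hU f).ae_eq⟩
  -- Linearity at every point, not just almost everywhere: continuous representatives are unique.
  · exact congrFun ((hU (f + g)).unique (map_add R f g ▸ (hU f).add (hU g))) x
  · exact congrFun ((hU (c • f)).unique (map_smul R c f ▸ (hU f).smul c)) x
  · exact LinearMap.mkContinuous_norm_le _ (Real.sqrt_nonneg _) _

/-! ### Multiplication operators composed with the resolvent -/

theorem aestronglyMeasurable_apply {B : ℝ → Spinor →L[ℂ] Spinor}
    (hB : AEStronglyMeasurable B volume) (f : L2) :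
    AEStronglyMeasurable (fun x => B x (f x)) volume :=
  (ContinuousLinearMap.id ℂ (Spinor →L[ℂ] Spinor)).aestronglyMeasurable_comp₂ hB
    (Lp.aestronglyMeasurable f)

theorem eLpNorm_two_eq (f : L2) : eLpNorm f 2 volume = ENNReal.ofReal ‖f‖ := by
  rw [← Lp.enorm_def, ofReal_norm]

/-- The product of a multiplication operator with `R` is a bounded operator as soon as it
satisfies a norm bound. -/
theorem exists_mul_comp_clm (R : L2 →L[ℂ] L2) {B : ℝ → Spinor →L[ℂ] Spinor}
    (hB : AEStronglyMeasurable B volume) {K : ℝ} (hK0 : 0 ≤ K)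
    (hK : ∀ f, eLpNorm (fun x => B x (R f x)) 2 volume ≤ ENNReal.ofReal (K * ‖f‖)) :
    ∃ T : L2 →L[ℂ] L2, ‖T‖ ≤ K ∧ ∀ f, T f =ᵐ[volume] fun x => B x (R f x) := by
  have hmem : ∀ f, MemLp (fun x => B x (R f x)) 2 volume := fun f =>
    ⟨aestronglyMeasurable_apply hB (R f), (hK f).trans_lt ENNReal.ofReal_lt_top⟩
  refine ⟨LinearMap.mkContinuous
    { toFun := fun f => (hmem f).toLp _
      map_add' := fun f g => ?_
      map_smul' := fun c f => ?_ } K fun f => ?_,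
    LinearMap.mkContinuous_norm_le _ hK0 _, fun f => (hmem f).coeFn_toLp⟩
  · rw [← MemLp.toLp_add, MemLp.toLp_eq_toLp_iff, map_add]
    filter_upwards [Lp.coeFn_add (R f) (R g)] with x hx
    simp only [hx, Pi.add_apply, map_add]
  · rw [RingHom.id_apply, ← MemLp.toLp_const_smul, MemLp.toLp_eq_toLp_iff, map_smul]
    filter_upwards [Lp.coeFn_smul c (R f)] with x hx
    simp only [hx, Pi.smul_apply, map_smul]
  · change ‖(hmem f).toLp _‖ ≤ _
    rw [Lp.norm_toLp]
    exact ENNReal.toReal_le_of_le_ofReal (by positivity) (hK f)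

theorem exists_mul_comp_clm_of_bounded (R : L2 →L[ℂ] L2) {B : ℝ → Spinor →L[ℂ] Spinor}
    (hB : AEStronglyMeasurable B volume) {ε : ℝ} (hε : 0 ≤ ε) (h : ∀ᵐ x, ‖B x‖ ≤ ε) :
    ∃ T : L2 →L[ℂ] L2, ‖T‖ ≤ ε * ‖R‖ ∧ ∀ f, T f =ᵐ[volume] fun x => B x (R f x) := by
  refine exists_mul_comp_clm R hB (by positivity) fun f => ?_
  have h1 : ∀ᵐ x, ‖B x (R f x)‖ ≤ ε * ‖R f x‖ := by
    filter_upwards [h] with x hx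
    exact (B x).le_of_opNorm_le hx _
  refine (eLpNorm_le_mul_eLpNorm_of_ae_le_mul h1 2).trans ?_
  rw [eLpNorm_two_eq, ← ENNReal.ofReal_mul hε, mul_assoc]
  gcongr
  exact R.le_opNorm f

/-- If point evaluations of the range of `R` are uniformly bounded, then the product of `R` with the
multiplication by a square integrable function is compact. -/
theorem exists_mul_comp_clm_of_memLp_two {R : L2 →L[ℂ] L2} {C : ℝ} {E : ℝ → L2 →L[ℂ] Spinor}
    (hE : ∀ x, ‖E x‖ ≤ C) (hRE : ∀ f, R f =ᵐ[volume] fun x => E x f)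
    {B : ℝ → Spinor →L[ℂ] Spinor} (hB : MemLp B 2 volume) :
    ∃ T : L2 →L[ℂ] L2, IsCompactOperator T ∧ ∀ f, T f =ᵐ[volume] fun x => B x (R f x) := by
  have hC : 0 ≤ C := (norm_nonneg _).trans (hE 0)
  obtain ⟨T, -, hT⟩ := exists_mul_comp_clm R hB.1 (K := C * (eLpNorm B 2 volume).toReal)
    (by positivity) fun f => by
      have h1 : ∀ᵐ x, ‖B x (R f x)‖ ≤ (C * ‖f‖) * ‖B x‖ := by
        filter_upwards [hRE f] with x hx
        rw [hx, mul_comm]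
        exact (B x).le_opNorm_of_le ((E x).le_of_opNorm_le (hE x) f)
      refine (eLpNorm_le_mul_eLpNorm_of_ae_le_mul h1 2).trans_eq ?_
      rw [mul_right_comm, ENNReal.ofReal_mul (by positivity : 0 ≤ C * ‖f‖),
        ENNReal.ofReal_toReal hB.2.ne]
  obtain ⟨w, b, -⟩ := exists_hilbertBasis ℂ L2
  refine ⟨T, isCompactOperator_of_sum_norm_sq_le b T (∫ x, 2 * C ^ 2 * ‖B x‖ ^ 2) fun s => ?_, hT⟩
  simp only [L2_norm_sq_eq_integral]
  rw [← integral_finsetSum _ fun i _ => L2_integrable_norm_sq (T (b i))]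
  refine integral_mono_ae (integrable_finsetSum _ fun i _ => L2_integrable_norm_sq (T (b i)))
    ((hB.integrable_norm_pow (by norm_num)).const_mul _) ?_
  -- As `s` is finite, one null set serves all `i`, and Bessel applies to `E x` at each remaining
  -- `x`.
  have h2 : ∀ᵐ x, ∀ i ∈ s, T (b i) x = B x (E x (b i)) := by
    rw [Filter.eventually_all_finset]
    intro i _
    filter_upwards [hT (b i), hRE (b i)] with x hx hx'
    rw [hx, hx']
  filter_upwards [h2] with x hx
  calc ∑ i ∈ s, ‖T (b i) x‖ ^ 2 ≤ ∑ i ∈ s, ‖B x‖ ^ 2 * ‖E x (b i)‖ ^ 2 := by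
        refine Finset.sum_le_sum fun i hi => ?_
        rw [hx i hi, ← mul_pow]
        gcongr
        exact (B x).le_opNorm _
    _ ≤ ‖B x‖ ^ 2 * (2 * C ^ 2) := by
        rw [← Finset.mul_sum]
        gcongr
        refine (sum_norm_sq_apply_le b.orthonormal (E x) s).trans ?_
        gcongr
        exact hE x
    _ = 2 * C ^ 2 * ‖B x‖ ^ 2 := mul_comm _ _

/-- A function in `L^r`, `2 ≤ r < ∞`, is the sum of a small function and a function in `L^2`. -/
theorem exists_small_add_memLp_two {F : Type*} [NormedAddCommGroup F] {B : ℝ → F} {r : ENNReal}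
    (hr : 2 ≤ r) (hr' : r ≠ ⊤) (hB : MemLp B r volume) {ε : ℝ} (hε : 0 < ε) :
    ∃ B₁ B₂ : ℝ → F, B = B₁ + B₂ ∧ AEStronglyMeasurable B₁ volume ∧ (∀ᵐ x, ‖B₁ x‖ ≤ ε) ∧
      MemLp B₂ 2 volume := by
  have hr0 : r ≠ 0 := fun h => by simp [h] at hr
  lift ε to NNReal using hε.le
  have hmk := hB.1.ae_eq_mk
  -- By Chebyshev this set has finite measure, so `L^r` embeds in `L²` on it; the measurable
  -- representative makes it measurable.
  set S : Set ℝ := {x | ε ≤ ‖hB.1.mk B x‖₊} with hS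
  have hSm : MeasurableSet S :=
    measurableSet_le measurable_const hB.1.stronglyMeasurable_mk.nnnorm.measurable
  have hSfin : volume S < ⊤ :=
    (hB.ae_eq hmk).meas_ge_lt_top hr0 hr' (by exact_mod_cast hε.ne')
  refine ⟨Sᶜ.indicator B, S.indicator B, (Set.indicator_compl_add_self S B).symm,
    hB.1.indicator hSm.compl, ?_, ?_⟩
  · filter_upwards [hmk] with x hx
    by_cases hxS : x ∈ S
    · simp [hxS]
    · rw [Set.indicator_of_mem hxS, hx]
      exact_mod_cast (not_le.1 hxS).le
  · rw [memLp_indicator_iff_restrict hSm]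
    have : IsFiniteMeasure (volume.restrict S) := ⟨by simpa using hSfin⟩
    exact (hB.restrict S).mono_exponent hr

/-- If point evaluations of the range of `R` are uniformly bounded, then the product of `R` with the
multiplication by a function in `L^r`, `2 ≤ r < ∞`, is compact. -/
theorem exists_mul_comp_clm_of_memLp {R : L2 →L[ℂ] L2} {C : ℝ} {E : ℝ → L2 →L[ℂ] Spinor}
    (hE : ∀ x, ‖E x‖ ≤ C) (hRE : ∀ f, R f =ᵐ[volume] fun x => E x f)
    {B : ℝ → Spinor →L[ℂ] Spinor} {r : ENNReal} (hr : 2 ≤ r) (hr' : r ≠ ⊤)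
    (hB : MemLp B r volume) :
    ∃ T : L2 →L[ℂ] L2, IsCompactOperator T ∧ ∀ f, T f =ᵐ[volume] fun x => B x (R f x) := by
  have key : ∀ ε : ℝ, 0 < ε → ∃ T S : L2 →L[ℂ] L2, (∀ f, T f =ᵐ[volume] fun x => B x (R f x)) ∧
      IsCompactOperator S ∧ ‖T - S‖ ≤ ε * ‖R‖ := by
    intro ε hε
    obtain ⟨B₁, B₂, rfl, hm, hle, h2⟩ := exists_small_add_memLp_two hr hr' hB hε
    obtain ⟨T₁, hT₁, h1⟩ := exists_mul_comp_clm_of_bounded R hm hε.le hle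
    obtain ⟨T₂, hT₂, h2⟩ := exists_mul_comp_clm_of_memLp_two hE hRE h2
    refine ⟨T₁ + T₂, T₂, fun f => ?_, hT₂, by simpa using hT₁⟩
    filter_upwards [Lp.coeFn_add (T₁ f) (T₂ f), h1 f, h2 f] with x hx hx1 hx2
    rw [add_apply, hx, Pi.add_apply, hx1, hx2]
    rfl
  obtain ⟨T, -, hT, -⟩ := key 1 one_pos
  refine ⟨T, ?_, hT⟩
  have hclosed : IsClosed {S : L2 →L[ℂ] L2 | IsCompactOperator S} :=
    isClosed_setOfPred_isCompactOperator
  refine hclosed.closure_subset (Metric.mem_closure_iff.2 fun δ hδ => ?_)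
  obtain ⟨T', S, hT', hS, hn⟩ := key (δ / (‖R‖ + 1)) (by positivity)
  -- The operator supplied by `key` depends formally on `ε`, but its almost everywhere formula
  -- determines it.
  have : T' = T := by
    ext1 f
    exact Lp.ext ((hT' f).trans (hT f).symm)
  subst this
  refine ⟨S, hS, ?_⟩
  rw [dist_eq_norm]
  refine hn.trans_lt ?_
  rw [div_mul_eq_mul_div, div_lt_iff₀ (by positivity)]
  nlinarith [norm_nonneg R]

end PeriodicDirac

theorem mainTheorem3
    (m : ℝ) (hm : 0 ≤ m)
    (a : ℝ) (ha : 0 < a)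
    (q : ℝ → ℝ) (hq : LocallyIntegrable q volume) (hper : Function.Periodic q a)
    (p : ℝ) (hp : 1 ≤ p)
    (A : ℝ → Matrix (Fin 2) (Fin 2) ℂ)
    (hA : PeriodicDirac.MatrixMemLp A (ENNReal.ofReal (2 * p)))
    (z : ℂ) (hz : z ∈ PeriodicDirac.resolventSet (PeriodicDirac.H0 m q)) :
    ∃ hdom : ∀ f : PeriodicDirac.L2,
        PeriodicDirac.resolvent (PeriodicDirac.H0 m q) z f ∈ (PeriodicDirac.mulOp A).domain,
      IsCompactOperator (fun f : PeriodicDirac.L2 =>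
        PeriodicDirac.mulOp A
          ⟨PeriodicDirac.resolvent (PeriodicDirac.H0 m q) z f, hdom f⟩) := by
  obtain ⟨C, E, hE, hRE⟩ := (PeriodicDirac.isResolventAt_resolvent hz).exists_eval
  have hr : (2 : ENNReal) ≤ ENNReal.ofReal (2 * p) := by
    rw [show (2 : ENNReal) = ENNReal.ofReal 2 by simp]
    exact ENNReal.ofReal_le_ofReal (by linarith)
  obtain ⟨T, hT, hTf⟩ :=
    PeriodicDirac.exists_mul_comp_clm_of_memLp hE hRE hr ENNReal.ofReal_ne_top hA
  have hdom : ∀ f : PeriodicDirac.L2,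
      PeriodicDirac.resolvent (PeriodicDirac.H0 m q) z f ∈ (PeriodicDirac.mulOp A).domain :=
    fun f => (Lp.memLp (T f)).ae_eq (hTf f)
  refine ⟨hdom, ?_⟩
  convert! hT using 1
  funext f
  exact Lp.ext ((MemLp.coeFn_toLp (hdom f)).trans (hTf f).symm)
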